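/- Let $C\subset\mathbb{R}^2$ be a compact convex set that is symmetric under the reflection in a line $\ell$. Let $R$ be a maximum area inscribed rectangle (MAIR) of $C$, i.e. a non-degenerate rectangle $R\subseteq C$ (in any orientation; so $C$ has non-empty interior) whose area is largest among all rectangles contained in $C$. Then: 1. The intersection $\ell\cap R$ is non-empty and is neither a single point nor an edge of $R$; that is, $\ell$ meets the interior of $R$. 2. Unless some corner of $R$ is an end point of the segment $\ell\cap C$, on each side of $\ell$ there is at least one corner of $R$ that lies on the boundary $\partial C$. 3. If $R$ is a square, then it does not have three corners strictly on one side of $\ell$. 4. If two corners of $R$ (a diagonal) lie on $\ell\cap C$, then $R$ is a square or $R$ makes an angle $\alpha$ with $\ell$ such that $\pi/6\le\alpha<\pi/4$, where the angle that a rectangle makes with a line is the smaller of the angles in $[0,\pi/2]$ between the line and the two side directions of the rectangle. -/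

import Mathlib

/-- The Euclidean plane. -/
abbrev Plane : Type := EuclideanSpace ℝ (Fin 2)

/-- A (non-degenerate) rectangle in the plane, given by its four corners in cyclic order. -/
structure Rectangle where
  /-- the corners, in cyclic order -/
  corner : Fin 4 → Plane
  parallelogram : corner 1 - corner 0 = corner 2 - corner 3
  perp : inner ℝ (corner 1 - corner 0) (corner 3 - corner 0) = 0
  ne_one : corner 0 ≠ corner 1
  ne_three : corner 0 ≠ corner 3

namespace Rectangle

/-- The region of the plane occupied by the rectangle. -/
def toSet (R : Rectangle) : Set Plane := convexHull ℝ (Set.range R.corner)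

/-- The edge that joins corner `i` to the next corner (indices modulo 4). -/
def edge (R : Rectangle) (i : Fin 4) : Set Plane := segment ℝ (R.corner i) (R.corner (i + 1))

/-- The area: the product of the lengths of two adjacent sides. -/
noncomputable def area (R : Rectangle) : ℝ :=
  dist (R.corner 0) (R.corner 1) * dist (R.corner 0) (R.corner 3)

/-- A square is a rectangle whose adjacent sides have the same length. -/
def IsSquare (R : Rectangle) : Prop :=
  dist (R.corner 0) (R.corner 1) = dist (R.corner 0) (R.corner 3)

end Rectangle

/-- The angle in `[0, π/2]` between a vector `v ≠ 0` and the line `ℓ`: the angle between `v` and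
its orthogonal projection to the direction of `ℓ` (it is `π/2` if that projection vanishes). -/
noncomputable def angleWithLine (ℓ : AffineSubspace ℝ Plane) (v : Plane) : ℝ :=
  InnerProductGeometry.angle v (ℓ.direction.starProjection v)

/-- The angle in `[0, π/4]` that a rectangle makes with the line `ℓ`: the smaller of the angles
between `ℓ` and the two side directions. -/
noncomputable def Rectangle.angle (R : Rectangle) (ℓ : AffineSubspace ℝ Plane) : ℝ :=
  min (angleWithLine ℓ (R.corner 1 - R.corner 0)) (angleWithLine ℓ (R.corner 3 - R.corner 0))

/-- `R` is a maximum area inscribed rectangle of `C`. -/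
def IsMAIR (C : Set Plane) (R : Rectangle) : Prop :=
  R.toSet ⊆ C ∧ ∀ R' : Rectangle, R'.toSet ⊆ C → R'.area ≤ R.area

/-- The part `ℓ ∩ C` of the line `ℓ` inside `C`. -/
def symAxis (ℓ : AffineSubspace ℝ Plane) (C : Set Plane) : Set Plane := (ℓ : Set Plane) ∩ C

open Filter Topology

/-- The four points `m ± d`, `m ± e` are the corners of a non-degenerate rectangle that has maximal
area among the rectangles with corners in the convex set `K`, which is symmetric in the first
coordinate axis. -/
structure IsMaxRect (K : Set (ℝ × ℝ)) (m d e : ℝ × ℝ) : Prop where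
  convex : Convex ℝ K
  symm : ∀ p ∈ K, (p.1, -p.2) ∈ K
  norm_eq : d.1 ^ 2 + d.2 ^ 2 = e.1 ^ 2 + e.2 ^ 2
  cross_ne : d.1 * e.2 - d.2 * e.1 ≠ 0
  add_left : m + d ∈ K
  sub_left : m - d ∈ K
  add_right : m + e ∈ K
  sub_right : m - e ∈ K
  max : ∀ m' d' e' : ℝ × ℝ, d'.1 ^ 2 + d'.2 ^ 2 = e'.1 ^ 2 + e'.2 ^ 2 →
    m' + d' ∈ K → m' - d' ∈ K → m' + e' ∈ K → m' - e' ∈ K →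
    |d'.1 * e'.2 - d'.2 * e'.1| ≤ |d.1 * e.2 - d.2 * e.1|

theorem mem_of_abs_add_abs_le {K : Set (ℝ × ℝ)} {m d e : ℝ × ℝ} (hK : Convex ℝ K)
    (h1 : m + d ∈ K) (h2 : m - d ∈ K) (h3 : m + e ∈ K) (h4 : m - e ∈ K) {s t : ℝ}
    (hst : |s| + |t| ≤ 1) : m + s • d + t • e ∈ K := by
  have key := hK.sum_mem (t := Finset.univ)
    (w := ![(|s| + s) / 2 + (1 - |s| - |t|) / 4, (|s| - s) / 2 + (1 - |s| - |t|) / 4,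
      (|t| + t) / 2 + (1 - |s| - |t|) / 4, (|t| - t) / 2 + (1 - |s| - |t|) / 4])
    (z := ![m + d, m - d, m + e, m - e]) ?_ ?_ ?_
  · convert key using 1
    simp only [Fin.sum_univ_four, Matrix.cons_val]
    ext <;> simp <;> ring
  · have := neg_abs_le s
    have := le_abs_self s
    have := neg_abs_le t
    have := le_abs_self t
    intro i _
    fin_cases i <;> simp <;> linarith
  · simp only [Fin.sum_univ_four, Matrix.cons_val]
    ring
  · intro i _
    fin_cases i <;> simpa

theorem mem_interior_of_abs_add_abs_lt {K : Set (ℝ × ℝ)} {m d e : ℝ × ℝ} (hK : Convex ℝ K)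
    (h1 : m + d ∈ K) (h2 : m - d ∈ K) (h3 : m + e ∈ K) (h4 : m - e ∈ K)
    (hc : d.1 * e.2 - d.2 * e.1 ≠ 0) {s t : ℝ}
    (hst : |s| + |t| < 1) : m + s • d + t • e ∈ interior K := by
  set N := d.1 * e.2 - d.2 * e.1 with hN
  let f : ℝ × ℝ → ℝ := fun p ↦ |((p.1 - m.1) * e.2 - (p.2 - m.2) * e.1) / N| +
    |(d.1 * (p.2 - m.2) - d.2 * (p.1 - m.1)) / N|
  have hf : Continuous f := by fun_prop
  refine mem_interior.2 ⟨{p | f p < 1}, fun p hp ↦ ?_, isOpen_lt hf continuous_const, ?_⟩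
  · convert mem_of_abs_add_abs_le hK h1 h2 h3 h4 (le_of_lt hp) using 1
    ext
    · simp
      field_simp
      rw [hN]; ring
    · simp
      field_simp
      rw [hN]; ring
  · have e1 : ((m + s • d + t • e).1 - m.1) * e.2 - ((m + s • d + t • e).2 - m.2) * e.1
        = s * N := by simp [hN]; ring
    have e2 : d.1 * ((m + s • d + t • e).2 - m.2) - d.2 * ((m + s • d + t • e).1 - m.1)
        = t * N := by simp [hN]; ring
    simp only [Set.mem_ofPred_eq, f, e1, e2, mul_div_cancel_right₀ _ hc]
    exact hst

theorem mem_interior_mirror {K : Set (ℝ × ℝ)} (hs : ∀ p ∈ K, (p.1, -p.2) ∈ K) {p : ℝ × ℝ}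
    (hp : p ∈ interior K) : (p.1, -p.2) ∈ interior K := by
  let h : ℝ × ℝ ≃ₜ ℝ × ℝ := (Homeomorph.refl ℝ).prodCongr (Homeomorph.neg ℝ)
  have hK : h ⁻¹' K = K := by
    ext q
    exact ⟨fun hq ↦ by simpa [h] using hs _ hq, fun hq ↦ hs q hq⟩
  have : p ∈ h ⁻¹' interior K := by rwa [h.preimage_interior, hK]
  exact this

theorem vertical_mem {K : Set (ℝ × ℝ)} (hK : Convex ℝ K) (hs : ∀ p ∈ K, (p.1, -p.2) ∈ K)
    {x y : ℝ} (h : (x, y) ∈ K) {z : ℝ} (hz : |z| ≤ |y|) : (x, z) ∈ K := by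
  by_cases hy : y = 0
  · subst hy
    have : z = 0 := by simpa using hz
    rwa [this]
  have h1 : |z / y| ≤ 1 := by
    rw [abs_div]
    exact div_le_one_of_le₀ hz (abs_nonneg _)
  have h2 := abs_le.1 h1
  convert hK h (hs _ h) (a := (1 + z / y) / 2) (b := (1 - z / y) / 2) (by linarith) (by linarith)
    (by ring) using 1
  ext
  · simp; ring
  · simp; field_simp; ring

namespace IsMaxRect

variable {K : Set (ℝ × ℝ)} {m d e : ℝ × ℝ}

theorem swap (h : IsMaxRect K m d e) : IsMaxRect K m e d where
  convex := h.convex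
  symm := h.symm
  norm_eq := h.norm_eq.symm
  cross_ne := fun h0 ↦ h.cross_ne (by linarith)
  add_left := h.add_right
  sub_left := h.sub_right
  add_right := h.add_left
  sub_right := h.sub_left
  max := fun m' d' e' hn h1 h2 h3 h4 ↦ by
    have := h.max m' d' e' hn h1 h2 h3 h4
    rwa [abs_sub_comm (d.1 * e.2), mul_comm d.2, mul_comm d.1] at this

theorem neg_right (h : IsMaxRect K m d e) : IsMaxRect K m d (-e) where
  convex := h.convex
  symm := h.symm
  norm_eq := by simpa using h.norm_eq
  cross_ne := fun h0 ↦ h.cross_ne (by simp at h0; linarith)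
  add_left := h.add_left
  sub_left := h.sub_left
  add_right := by simpa [sub_eq_add_neg] using h.sub_right
  sub_right := by simpa using h.add_right
  max := fun m' d' e' hn h1 h2 h3 h4 ↦ by
    have := h.max m' d' e' hn h1 h2 h3 h4
    rwa [← abs_neg (d.1 * e.2 - _), show -(d.1 * e.2 - d.2 * e.1) =
      d.1 * (-e).2 - d.2 * (-e).1 by simp; ring] at this

theorem mirror (h : IsMaxRect K m d e) : IsMaxRect K (m.1, -m.2) (d.1, -d.2) (e.1, -e.2) where
  convex := h.convex
  symm := h.symm
  norm_eq := by simpa using h.norm_eq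
  cross_ne := fun h0 ↦ h.cross_ne (by simp at h0; linarith)
  add_left := by convert h.symm _ h.add_left using 1; ext <;> simp; ring
  sub_left := by convert h.symm _ h.sub_left using 1; ext <;> simp; ring
  add_right := by convert h.symm _ h.add_right using 1; ext <;> simp; ring
  sub_right := by convert h.symm _ h.sub_right using 1; ext <;> simp; ring
  max := fun m' d' e' hn h1 h2 h3 h4 ↦ by
    have := h.max m' d' e' hn h1 h2 h3 h4
    rwa [← abs_neg (d.1 * e.2 - _), show -(d.1 * e.2 - d.2 * e.1) =
      d.1 * (-e.2) - (-d.2) * e.1 by ring] at this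

theorem two_mul_le (h : IsMaxRect K m d e) {x w y : ℝ} (h1 : (x + w, y) ∈ K)
    (h2 : (x - w, y) ∈ K) : |2 * w * y| ≤ |d.1 * e.2 - d.2 * e.1| := by
  have := h.max (x, 0) (w, y) (-w, y) (by simp) (by simpa using h1)
    (by simpa using h.symm _ h2) (by simpa [sub_eq_add_neg] using h2)
    (by simpa using h.symm _ h1)
  convert this using 2
  ring

theorem exists_neg (h : IsMaxRect K m d e) : m.2 + d.2 < 0 ∨ m.2 - d.2 < 0 ∨
    m.2 + e.2 < 0 ∨ m.2 - e.2 < 0 := by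
  by_contra! hcon
  obtain ⟨k1, k2, k3, k4⟩ := hcon
  have hd : |d.2| ≤ m.2 := abs_le.2 ⟨by linarith, by linarith⟩
  have he : |e.2| ≤ m.2 := abs_le.2 ⟨by linarith, by linarith⟩
  have hN := abs_pos.2 h.cross_ne
  have hnorm := h.norm_eq
  have hpos : 0 < |d.2| + |e.2| := by
    by_contra! h0
    have a1 : d.2 = 0 := abs_eq_zero.1 (by linarith [abs_nonneg d.2, abs_nonneg e.2])
    have a2 : e.2 = 0 := abs_eq_zero.1 (by linarith [abs_nonneg d.2, abs_nonneg e.2])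
    exact h.cross_ne (by simp [a1, a2])
  have hm : 0 < m.2 := by linarith
  have mem : ∀ k : ℝ, |k| * (|d.2| + |e.2|) ≤ 1 →
      (m.1 + k * (d.1 * e.2 - d.2 * e.1), m.2) ∈ K := fun k hk ↦ by
    convert mem_of_abs_add_abs_le h.convex h.add_left h.sub_left h.add_right h.sub_right
      (s := k * e.2) (t := -(k * d.2)) (by rw [abs_neg, abs_mul, abs_mul]; linarith) using 1
    ext <;> simp <;> ring
  have ha : |(|d.2| + |e.2|)⁻¹| * (|d.2| + |e.2|) ≤ 1 := by
    rw [abs_of_pos (inv_pos.2 hpos), inv_mul_cancel₀ hpos.ne']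
  have key := h.two_mul_le (x := m.1) (y := m.2) (mem (|d.2| + |e.2|)⁻¹ ha)
    (by simpa [sub_eq_add_neg] using mem (-(|d.2| + |e.2|)⁻¹) (by simpa using ha))
  rw [abs_mul, abs_mul, abs_mul, abs_of_pos (inv_pos.2 hpos), abs_of_pos hm, abs_two] at key
  have key2 : 2 * m.2 ≤ |d.2| + |e.2| := by
    have e1 : 2 * ((|d.2| + |e.2|)⁻¹ * |d.1 * e.2 - d.2 * e.1|) * m.2 =
      |d.1 * e.2 - d.2 * e.1| * (2 * m.2 / (|d.2| + |e.2|)) := by ring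
    rw [e1] at key
    have := le_of_mul_le_mul_left (key.trans_eq (mul_one _).symm) hN
    rwa [div_le_one hpos] at this
  have hd' : |d.2| = m.2 := by linarith
  have he' : |e.2| = m.2 := by linarith
  have hsq : d.1 ^ 2 = e.1 ^ 2 := by
    have := sq_abs d.2
    have := sq_abs e.2
    rw [hd'] at *
    rw [he'] at *
    linarith
  have fin : ∀ w : ℝ, (m.1 + w, 2 * m.2) ∈ K → (m.1 - w, 2 * m.2) ∈ K →
      |w * m.2 * 2| = |d.1 * e.2 - d.2 * e.1| → False := fun w h1 h2 h3 ↦ by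
    have := h.two_mul_le h1 h2
    rw [← h3, show 2 * w * (2 * m.2) = 2 * (w * m.2 * 2) by ring, abs_mul,
      abs_two] at this
    linarith
  have A1 := h.add_left
  have A2 := h.sub_left
  have A3 := h.add_right
  have A4 := h.sub_right
  have c := h.cross_ne
  obtain ⟨m1, m2⟩ := m
  obtain ⟨d1, d2⟩ := d
  obtain ⟨e1, e2⟩ := e
  simp only [Prod.mk_add_mk, Prod.mk_sub_mk] at *
  rcases sq_eq_sq_iff_eq_or_eq_neg.1 hsq with rfl | rfl <;>
  rcases (abs_eq hm.le).1 hd' with rfl | rfl <;>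
  rcases (abs_eq hm.le).1 he' with rfl | rfl
  · exact c (by ring)
  · refine fin d1 (by convert A1 using 2; ring) (by convert A4 using 2; ring) ?_
    exact abs_eq_abs.2 (Or.inr (by ring))
  · refine fin d1 (by convert A3 using 2; ring) (by convert A2 using 2; ring) ?_
    exact abs_eq_abs.2 (Or.inl (by ring))
  · exact c (by ring)
  · refine fin e1 (by convert A3 using 2; ring) (by convert A1 using 2 <;> ring) ?_
    exact abs_eq_abs.2 (Or.inr (by ring))
  · exact c (by ring)
  · exact c (by ring)
  · refine fin e1 (by convert A2 using 2 <;> ring) (by convert A4 using 2; ring) ?_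
    exact abs_eq_abs.2 (Or.inl (by ring))

theorem exists_pos (h : IsMaxRect K m d e) : 0 < m.2 + d.2 ∨ 0 < m.2 - d.2 ∨
    0 < m.2 + e.2 ∨ 0 < m.2 - e.2 := by
  have := h.mirror.exists_neg
  simp only at this
  rcases this with h | h | h | h
  · left; linarith
  · right; left; linarith
  · right; right; left; linarith
  · right; right; right; linarith

theorem axis_mem_interior (h : IsMaxRect K m d e) : (m.1, 0) ∈ interior K := by
  have h1 : m ∈ interior K := by
    simpa using mem_interior_of_abs_add_abs_lt h.convex h.add_left h.sub_left h.add_right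
      h.sub_right h.cross_ne (s := 0) (t := 0) (by simp)
  convert h.convex.interior h1 (mem_interior_mirror h.symm h1) (a := 1 / 2) (b := 1 / 2)
    (by norm_num) (by norm_num) (by norm_num) using 1
  ext <;> simp
  ring

/-- A point of the axis is interior if the set has points strictly to its left and right. -/
theorem mem_interior_of_lt_of_lt (h : IsMaxRect K m d e) {p q : ℝ × ℝ} (hp : p ∈ K) (hq : q ∈ K)
    {x : ℝ} (hpx : p.1 < x) (hxq : x < q.1) : (x, 0) ∈ interior K := by
  have hm := h.axis_mem_interior
  have aux : ∀ q ∈ K, m.1 < x ∧ x < q.1 ∨ q.1 < x ∧ x < m.1 → (x, 0) ∈ interior K := by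
    intro q hq hx
    have hq0 : (q.1, 0) ∈ K := vertical_mem h.convex h.symm (x := q.1) (y := q.2) hq (by simp)
    refine h.convex.openSegment_interior_self_subset_interior hm hq0 ?_
    have hne : q.1 - m.1 ≠ 0 := by rcases hx with h | h <;> intro h0 <;> linarith
    refine ⟨(q.1 - x) / (q.1 - m.1), (x - m.1) / (q.1 - m.1), ?_, ?_, ?_, ?_⟩
    · rcases hx with h | h
      · exact div_pos (by linarith) (by linarith)
      · exact div_pos_of_neg_of_neg (by linarith) (by linarith)
    · rcases hx with h | h
      · exact div_pos (by linarith) (by linarith)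
      · exact div_pos_of_neg_of_neg (by linarith) (by linarith)
    · field_simp; ring
    · ext
      · simp; field_simp; ring
      · simp
  rcases lt_trichotomy x m.1 with hx | hx | hx
  · exact aux p hp (Or.inr ⟨hpx, hx⟩)
  · rwa [hx]
  · exact aux q hq (Or.inl ⟨hx, hxq⟩)

theorem mem_interior_of_between (h : IsMaxRect K m d e) {p : ℝ × ℝ} (hp : p ∈ K)
    (hp0 : (p.1, 0) ∈ interior K) {z : ℝ} (hz : |z| < |p.2|) : (p.1, z) ∈ interior K := by
  have hy : p.2 ≠ 0 := fun h0 ↦ by simp [h0] at hz; linarith [abs_nonneg z]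
  have hpos : 0 < |p.2| := abs_pos.2 hy
  have aux : ∀ y : ℝ, y ≠ 0 → (p.1, y) ∈ K → 0 ≤ z / y → z / y < 1 → (p.1, z) ∈ interior K := by
    intro y hy0 hy h1 h2
    rcases h1.eq_or_lt with h1 | h1
    · have : z = 0 := by
        rcases div_eq_zero_iff.1 h1.symm with h | h
        · exact h
        · exact absurd h hy0
      rwa [this]
    refine h.convex.openSegment_interior_self_subset_interior hp0 hy
      ⟨1 - z / y, z / y, by linarith, h1, by ring, ?_⟩
    ext
    · simp; ring
    · simp; field_simp
  have habs : |z / p.2| < 1 := by rwa [abs_div, div_lt_one hpos]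
  obtain ⟨a1, a2⟩ := abs_lt.1 habs
  rcases le_total 0 (z / p.2) with h1 | h1
  · exact aux p.2 hy hp h1 a2
  · refine aux (-p.2) (neg_ne_zero.2 hy) (h.symm _ hp) ?_ ?_
    · rw [div_neg]; linarith
    · rw [div_neg]; linarith

/-- A rectangle is not maximal if it can be moved upwards so that two opposite corners become
interior and the other two can still be moved up and down. -/
theorem false_of_vertical_slack (h : IsMaxRect K m d e) {c : ℝ × ℝ}
    (h1 : ∀ᶠ s in 𝓝 (0 : ℝ), c + d + (0, s) ∈ K)
    (h2 : ∀ᶠ s in 𝓝 (0 : ℝ), c - d + (0, s) ∈ K)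
    (h3 : c + e ∈ interior K) (h4 : c - e ∈ interior K) : False := by
  have hD : 0 < d.1 ^ 2 + d.2 ^ 2 := by
    by_contra! h0
    have a1 : d.1 = 0 := by nlinarith [sq_nonneg d.1, sq_nonneg d.2]
    have a2 : d.2 = 0 := by nlinarith [sq_nonneg d.1, sq_nonneg d.2]
    exact h.cross_ne (by simp [a1, a2])
  set D := d.1 ^ 2 + d.2 ^ 2 with hDdef
  let f : ℝ → ℝ × ℝ := fun s ↦
    (e.1 + s / D * (d.2 * e.1 - d.1 * e.2), e.2 + s / D * (d.2 * e.2 + d.1 * e.1))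
  have hf : Continuous f := by fun_prop
  have hf0 : f 0 = e := by simp [f]
  have h3' : ∀ᶠ s in 𝓝 (0 : ℝ), c + f s ∈ interior K :=
    (by fun_prop : Continuous fun s ↦ c + f s).tendsto 0 (isOpen_interior.mem_nhds (by rwa [hf0]))
  have h4' : ∀ᶠ s in 𝓝 (0 : ℝ), c - f s ∈ interior K :=
    (by fun_prop : Continuous fun s ↦ c - f s).tendsto 0 (isOpen_interior.mem_nhds (by rwa [hf0]))
  have h2' : ∀ᶠ s in 𝓝 (0 : ℝ), c - d + (0, -s) ∈ K := by
    have : Tendsto (fun s : ℝ ↦ -s) (𝓝 0) (𝓝 0) := by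
      simpa using (continuous_neg.tendsto (0 : ℝ))
    exact this.eventually h2
  obtain ⟨δ, hδ, H⟩ := Metric.eventually_nhds_iff.1 (h1.and (h2'.and (h3'.and h4')))
  obtain ⟨s, hs0, hs, hsd⟩ : ∃ s : ℝ, s ≠ 0 ∧ |s| < δ ∧ 0 ≤ d.2 * s := by
    rcases le_total 0 d.2 with h0 | h0
    · exact ⟨δ / 2, by positivity, by rw [abs_of_pos (by positivity)]; linarith, by positivity⟩
    · exact ⟨-(δ / 2), by simp; positivity, by rw [abs_neg, abs_of_pos (by positivity)]; linarith,
        by nlinarith⟩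
  obtain ⟨k1, k2, k3, k4⟩ := H (y := s) (by simpa using hs)
  have hcr : d.1 * (f s).2 - (d.2 + s) * (f s).1 =
      (d.1 * e.2 - d.2 * e.1) * (1 + (2 * (d.2 * s) + s ^ 2) / D) := by
    simp only [f]
    field_simp
    rw [hDdef]
    ring
  have key := h.max c (d + (0, s)) (f s) ?_ ?_ ?_ (interior_subset k3) (interior_subset k4)
  · have hN := abs_pos.2 h.cross_ne
    have hpos : 0 < (2 * (d.2 * s) + s ^ 2) / D := div_pos (by positivity) hD
    simp only [Prod.fst_add, Prod.snd_add, add_zero, hcr] at key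
    rw [abs_mul, abs_of_pos (by linarith : 0 < 1 + (2 * (d.2 * s) + s ^ 2) / D)] at key
    nlinarith
  · have hn : e.1 ^ 2 + e.2 ^ 2 = D := h.norm_eq.symm
    have : (f s).1 ^ 2 + (f s).2 ^ 2 =
        (e.1 ^ 2 + e.2 ^ 2) * (1 + (2 * (d.2 * s)) / D + s ^ 2 * (d.1 ^ 2 + d.2 ^ 2) / D ^ 2) := by
      simp only [f]
      field_simp
      ring
    rw [this, hn, ← hDdef]
    simp only [Prod.fst_add, Prod.snd_add, add_zero]
    field_simp
    rw [hDdef]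
    ring
  · rwa [← add_assoc]
  · convert k2 using 1
    ext <;> simp; ring

theorem false_of_upper_corners_mem_interior_of_le (h : IsMaxRect K m d e)
    (h1 : 0 ≤ m.2 + d.2 → m + d ∈ interior K) (h2 : 0 ≤ m.2 - d.2 → m - d ∈ interior K)
    (h3 : 0 ≤ m.2 + e.2 → m + e ∈ interior K) (h4 : 0 ≤ m.2 - e.2 → m - e ∈ interior K)
    (hle : |e.1| ≤ |d.1|) : False := by
  have near : ∀ p ∈ interior K, ∀ᶠ ε in 𝓝 (0 : ℝ), p + (0, ε) ∈ interior K := fun p hp ↦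
    (by fun_prop : Continuous fun ε : ℝ ↦ p + (0, ε)).tendsto 0
      (isOpen_interior.mem_nhds (by convert hp using 1; ext <;> simp))
  have slack : ∀ p ∈ K, (0 ≤ p.2 → p ∈ interior K) →
      ∀ᶠ ε in 𝓝[>] (0 : ℝ), ∀ᶠ s in 𝓝 (0 : ℝ), p + (0, ε) + (0, s) ∈ K := by
    intro p hp hi
    by_cases hp2 : 0 ≤ p.2
    · filter_upwards [nhdsWithin_le_nhds (near p (hi hp2))] with ε hε
      filter_upwards [near _ hε] with s hs using interior_subset hs
    · push Not at hp2
      filter_upwards [Ioo_mem_nhdsGT (neg_pos.2 hp2)] with ε hε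
      have hlt : |p.2 + ε + 0| < |p.2| := by
        rw [abs_of_neg hp2, abs_lt]; constructor <;> linarith [hε.1, hε.2]
      have hc : Continuous fun s : ℝ ↦ |p.2 + ε + s| := by fun_prop
      filter_upwards [(hc.tendsto 0).eventually_lt_const hlt] with s hs
      convert vertical_mem h.convex h.symm (x := p.1) (y := p.2) hp hs.le using 1
      ext <;> simp
  have inner : ∀ p ∈ K, (0 ≤ p.2 → p ∈ interior K) → (p.2 < 0 → (p.1, 0) ∈ interior K) →
      ∀ᶠ ε in 𝓝[>] (0 : ℝ), p + (0, ε) ∈ interior K := by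
    intro p hp hi h0
    by_cases hp2 : 0 ≤ p.2
    · exact nhdsWithin_le_nhds (near p (hi hp2))
    · push Not at hp2
      filter_upwards [Ioo_mem_nhdsGT (neg_pos.2 hp2)] with ε hε
      have hlt : |p.2 + ε| < |p.2| := by
        rw [abs_of_neg hp2, abs_lt]; constructor <;> linarith [hε.1, hε.2]
      convert h.mem_interior_of_between hp (h0 hp2) hlt using 1
      ext <;> simp
  -- a point on the vertical line of an interior point projects into the interior
  have proj : ∀ p ∈ interior K, (p.1, 0) ∈ interior K := by
    intro p hp
    convert h.convex.interior hp (mem_interior_mirror h.symm hp) (a := 1 / 2) (b := 1 / 2)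
      (by norm_num) (by norm_num) (by norm_num) using 1
    ext <;> simp
    ring
  have foot : (m.2 + e.2 < 0 → (m.1 + e.1, 0) ∈ interior K) ∧
      (m.2 - e.2 < 0 → (m.1 - e.1, 0) ∈ interior K) := by
    rcases hle.lt_or_eq with hlt | heq
    · have he1 := le_abs_self e.1
      have he2 := neg_abs_le e.1
      rcases le_total 0 d.1 with h0 | h0
      · rw [abs_of_nonneg h0] at hlt
        exact ⟨fun _ ↦ h.mem_interior_of_lt_of_lt h.sub_left h.add_left
            (by simp; linarith) (by simp; linarith),
          fun _ ↦ h.mem_interior_of_lt_of_lt h.sub_left h.add_left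
            (by simp; linarith) (by simp; linarith)⟩
      · rw [abs_of_nonpos h0] at hlt
        exact ⟨fun _ ↦ h.mem_interior_of_lt_of_lt h.add_left h.sub_left
            (by simp; linarith) (by simp; linarith),
          fun _ ↦ h.mem_interior_of_lt_of_lt h.add_left h.sub_left
            (by simp; linarith) (by simp; linarith)⟩
    · have hsq2 : d.2 ^ 2 = e.2 ^ 2 := by
        have := h.norm_eq
        have := sq_abs d.1
        have := sq_abs e.1
        rw [heq] at *
        linarith
      have hpos := h.exists_pos
      have hc := h.cross_ne
      rcases abs_eq_abs.1 heq with h5 | h5 <;> rcases sq_eq_sq_iff_eq_or_eq_neg.1 hsq2 with h6 | h6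
      · exact absurd (by rw [h5, h6]; ring) hc
      · refine ⟨fun hlt ↦ ?_, fun hlt ↦ ?_⟩
        · have := proj _ (h1 (by rcases hpos with k | k | k | k <;> linarith))
          simpa [h5] using this
        · have := proj _ (h2 (by rcases hpos with k | k | k | k <;> linarith))
          simpa [h5] using this
      · refine ⟨fun hlt ↦ ?_, fun hlt ↦ ?_⟩
        · have := proj _ (h2 (by rcases hpos with k | k | k | k <;> linarith))
          simpa [h5, sub_eq_add_neg] using this
        · have := proj _ (h1 (by rcases hpos with k | k | k | k <;> linarith))
          simpa [h5, sub_eq_add_neg] using this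
      · exact absurd (by rw [h6, ← neg_eq_iff_eq_neg.2 h5]; ring) hc
  obtain ⟨ε, k1, k2, k3, k4⟩ := ((slack _ h.add_left (by simpa using h1)).and
    ((slack _ h.sub_left (by simpa using h2)).and
    ((inner _ h.add_right (by simpa using h3) (by simpa using foot.1)).and
    (inner _ h.sub_right (by simpa using h4) (by simpa using foot.2))))).exists
  refine h.false_of_vertical_slack (c := m + (0, ε)) ?_ ?_ ?_ ?_
  · filter_upwards [k1] with s hs
    rwa [add_right_comm m]
  · filter_upwards [k2] with s hs
    rwa [add_sub_right_comm]
  · rwa [add_right_comm]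
  · rwa [add_sub_right_comm]

theorem false_of_upper_corners_mem_interior (h : IsMaxRect K m d e)
    (h1 : 0 ≤ m.2 + d.2 → m + d ∈ interior K) (h2 : 0 ≤ m.2 - d.2 → m - d ∈ interior K)
    (h3 : 0 ≤ m.2 + e.2 → m + e ∈ interior K) (h4 : 0 ≤ m.2 - e.2 → m - e ∈ interior K) :
    False := by
  rcases le_total |e.1| |d.1| with hle | hle
  · exact h.false_of_upper_corners_mem_interior_of_le h1 h2 h3 h4 hle
  · exact h.swap.false_of_upper_corners_mem_interior_of_le h3 h4 h1 h2 hle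

/-- A maximal square does not have three corners above the axis. -/
theorem false_of_three_pos (h : IsMaxRect K m d e) (hperp : d.1 * e.1 + d.2 * e.2 = 0)
    (h1 : 0 < m.2 + d.2) (h2 : 0 < m.2 - d.2) (h3 : 0 < m.2 + e.2) : False := by
  have h4 : m.2 - e.2 < 0 := by
    rcases h.exists_neg with k | k | k | k <;> linarith
  have hn := h.norm_eq
  have hr : 0 < d.1 ^ 2 + d.2 ^ 2 := by
    by_contra! h0
    have a1 : d.1 = 0 := by nlinarith [sq_nonneg d.1, sq_nonneg d.2]
    have a2 : d.2 = 0 := by nlinarith [sq_nonneg d.1, sq_nonneg d.2]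
    exact h.cross_ne (by simp [a1, a2])
  have hr2 : d.2 ^ 2 + e.2 ^ 2 = d.1 ^ 2 + d.2 ^ 2 := by
    have : (d.1 ^ 2 + d.2 ^ 2) * (e.2 ^ 2 - d.1 ^ 2) = 0 := by
      linear_combination (-d.1 ^ 2) * hn + (d.2 * e.2 - d.1 * e.1) * hperp
    rcases mul_eq_zero.1 this with k | k <;> linarith
  have hx : d.1 * d.2 + e.1 * e.2 = 0 := by
    have : (d.1 ^ 2 + d.2 ^ 2) * (d.1 * d.2 + e.1 * e.2) = 0 := by
      linear_combination (d.1 * e.2 + d.2 * e.1) * hperp + d.1 * d.2 * hn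
    rcases mul_eq_zero.1 this with k | k <;> linarith
  set r := d.1 ^ 2 + d.2 ^ 2 with hrdef
  set k := e.2 - m.2 with hk
  have hd2 : |d.2| < m.2 := abs_lt.2 ⟨by linarith, by linarith⟩
  have hd0 := abs_nonneg d.2
  have hmem : m - e ∈ interior K := by
    have := mem_interior_of_abs_add_abs_lt h.convex h.add_left h.sub_left h.add_right
      h.sub_right h.cross_ne (s := 2 * k * d.2 / r) (t := (2 * k * e.2 - r) / r) (by
        rw [abs_div, abs_div, abs_of_pos hr, ← add_div, div_lt_one hr, abs_mul,
          abs_of_pos (by linarith : 0 < 2 * k)]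
        have hsq := sq_abs d.2
        rcases abs_cases (2 * k * e.2 - r) with ⟨q, _⟩ | ⟨q, _⟩ <;> rw [q] <;> nlinarith)
    convert mem_interior_mirror h.symm this using 1
    ext
    · simp
      field_simp
      linear_combination (-2 * k) * hx
    · simp
      field_simp
      rw [← hr2]
      ring
  refine h.mirror.false_of_upper_corners_mem_interior ?_ ?_ ?_ ?_ <;> simp only <;> intro h0
  · linarith
  · linarith
  · linarith
  · convert mem_interior_mirror h.symm hmem using 1
    ext <;> simp
    ring

/-- If a diagonal of a maximal rectangle lies on the axis, then the angle between the diagonals is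
at least `π / 3`. -/
theorem two_mul_abs_le (h : IsMaxRect K m d e) (hm : m.2 = 0) (hd : d.2 = 0) :
    2 * |e.1| ≤ |d.1| := by
  have h1 := h.add_right
  have h2 := h.symm _ h.sub_right
  have := h.two_mul_le (x := m.1) (w := e.1) (y := e.2) (by convert h1 using 1; ext <;> simp [hm])
    (by convert h2 using 1; ext <;> simp [hm])
  have hc := h.cross_ne
  rw [hd, zero_mul, sub_zero] at this hc
  rw [abs_mul, abs_mul, abs_mul, abs_two] at this
  exact le_of_mul_le_mul_right this (abs_pos.2 (right_ne_zero_of_mul hc))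

end IsMaxRect

/-- Cartesian coordinates of the plane with origin `o` and first axis in direction of the unit
vector `u`. -/
noncomputable def frame (o u : Plane) (hu : u 0 ^ 2 + u 1 ^ 2 = 1) : ℝ × ℝ ≃ₜ Plane where
  toFun p := !₂[o 0 + p.1 * u 0 - p.2 * u 1, o 1 + p.1 * u 1 + p.2 * u 0]
  invFun z := ((z 0 - o 0) * u 0 + (z 1 - o 1) * u 1, (z 1 - o 1) * u 0 - (z 0 - o 0) * u 1)
  left_inv p := by
    ext
    · simp; linear_combination p.1 * hu
    · simp; linear_combination p.2 * hu
  right_inv z := by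
    ext i
    fin_cases i
    · simp; linear_combination (z 0 - o 0) * hu
    · simp; linear_combination (z 1 - o 1) * hu
  continuous_toFun := by fun_prop
  continuous_invFun := by fun_prop

section frame

variable {o u : Plane} {hu : u 0 ^ 2 + u 1 ^ 2 = 1}

theorem frame_apply_zero (p : ℝ × ℝ) : frame o u hu p 0 = o 0 + p.1 * u 0 - p.2 * u 1 := rfl

theorem frame_apply_one (p : ℝ × ℝ) : frame o u hu p 1 = o 1 + p.1 * u 1 + p.2 * u 0 := rfl

theorem frame_combo {a b : ℝ} (hab : a + b = 1) (p q : ℝ × ℝ) :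
    frame o u hu (a • p + b • q) = a • frame o u hu p + b • frame o u hu q := by
  obtain rfl : b = 1 - a := by linarith
  ext i
  fin_cases i
  · simp [frame_apply_zero]; ring
  · simp [frame_apply_one]; ring

theorem convex_preimage_frame {C : Set Plane} (hC : Convex ℝ C) :
    Convex ℝ (frame o u hu ⁻¹' C) := by
  intro p hp q hq a b ha hb hab
  rw [Set.mem_preimage, frame_combo hab]
  exact hC hp hq ha hb hab

theorem inner_frame_sub (p q r s : ℝ × ℝ) :
    inner ℝ (frame o u hu p - frame o u hu q) (frame o u hu r - frame o u hu s) =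
      (p.1 - q.1) * (r.1 - s.1) + (p.2 - q.2) * (r.2 - s.2) := by
  simp only [PiLp.inner_apply, Fin.sum_univ_two, PiLp.sub_apply, frame_apply_zero,
    frame_apply_one, RCLike.inner_apply, conj_trivial]
  linear_combination ((p.1 - q.1) * (r.1 - s.1) + (p.2 - q.2) * (r.2 - s.2)) * hu

theorem dist_frame (p q : ℝ × ℝ) :
    dist (frame o u hu p) (frame o u hu q) = √((p.1 - q.1) ^ 2 + (p.2 - q.2) ^ 2) := by
  rw [dist_eq_norm, norm_eq_sqrt_real_inner, inner_frame_sub, sq, sq]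

theorem inner_axis_frame_sub (p q : ℝ × ℝ) :
    inner ℝ u (frame o u hu p - frame o u hu q) = p.1 - q.1 := by
  simp only [PiLp.inner_apply, Fin.sum_univ_two, PiLp.sub_apply, frame_apply_zero,
    frame_apply_one, RCLike.inner_apply, conj_trivial]
  linear_combination (p.1 - q.1) * hu

theorem norm_axis (hu : u 0 ^ 2 + u 1 ^ 2 = 1) : ‖u‖ = 1 := by
  rw [EuclideanSpace.norm_eq, Fin.sum_univ_two]
  simp [hu]

variable {ℓ : AffineSubspace ℝ Plane}

theorem frame_mem_iff (ho : o ∈ ℓ) (hℓ : ℓ.direction = ℝ ∙ u) (p : ℝ × ℝ) :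
    frame o u hu p ∈ ℓ ↔ p.2 = 0 := by
  rw [← AffineSubspace.vsub_right_mem_direction_iff_mem ho, hℓ, Submodule.mem_span_singleton]
  constructor
  · rintro ⟨c, hc⟩
    have h0 := congrArg (fun z : Plane ↦ z 0) hc
    have h1 := congrArg (fun z : Plane ↦ z 1) hc
    simp [frame_apply_zero, frame_apply_one] at h0 h1
    linear_combination (-p.2) * hu - u 0 * h1 + u 1 * h0
  · intro hp
    refine ⟨p.1, ?_⟩
    ext i
    fin_cases i
    · simp [frame_apply_zero, hp]
    · simp [frame_apply_one, hp]

theorem reflection_frame [Nonempty ℓ] (ho : o ∈ ℓ) (hℓ : ℓ.direction = ℝ ∙ u) (p : ℝ × ℝ) :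
    EuclideanGeometry.reflection ℓ (frame o u hu p) = frame o u hu (p.1, -p.2) := by
  have h1 : frame o u hu p = p.2 • (!₂[-u 1, u 0] : Plane) +ᵥ frame o u hu (p.1, 0) := by
    ext i
    fin_cases i
    · simp [frame_apply_zero]; ring
    · simp [frame_apply_one]; ring
  have h2 : frame o u hu (p.1, -p.2) =
      -(p.2 • (!₂[-u 1, u 0] : Plane)) +ᵥ frame o u hu (p.1, 0) := by
    ext i
    fin_cases i
    · simp [frame_apply_zero]; ring
    · simp [frame_apply_one]; ring
  rw [h1, h2]
  refine EuclideanGeometry.reflection_orthogonal_vadd ((frame_mem_iff ho hℓ _).2 rfl) ?_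
  refine Submodule.smul_mem _ _ ?_
  rw [hℓ, Submodule.mem_orthogonal_singleton_iff_inner_right]
  simp [PiLp.inner_apply, Fin.sum_univ_two]
  ring

theorem exists_frame [Nonempty ℓ] (hline : Module.finrank ℝ ℓ.direction = 1) :
    ∃ o u : Plane, u 0 ^ 2 + u 1 ^ 2 = 1 ∧ o ∈ ℓ ∧ ℓ.direction = ℝ ∙ u := by
  obtain ⟨o, ho⟩ := ‹Nonempty ℓ›
  obtain ⟨v, hv, hv0, hspan⟩ :
      ∃ v : Plane, v ∈ ℓ.direction ∧ v ≠ 0 ∧ ∀ w ∈ ℓ.direction, ∃ c : ℝ, c • v = w := by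
    obtain ⟨v, hv, h⟩ := finrank_eq_one_iff'.1 hline
    refine ⟨v, v.2, by simpa using hv, fun w hw ↦ ?_⟩
    obtain ⟨c, hc⟩ := h ⟨w, hw⟩
    exact ⟨c, congrArg Subtype.val hc⟩
  have hn : ‖v‖ ≠ 0 := norm_ne_zero_iff.2 hv0
  refine ⟨o, ‖v‖⁻¹ • v, ?_, ho, ?_⟩
  · have h1 : ‖v‖ ^ 2 = v 0 ^ 2 + v 1 ^ 2 := by
      rw [EuclideanSpace.norm_sq_eq, Fin.sum_univ_two]; simp
    simp only [PiLp.smul_apply, smul_eq_mul]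
    field_simp
    exact h1.symm
  · refine le_antisymm (fun w hw ↦ ?_) ?_
    · obtain ⟨c, rfl⟩ := hspan w hw
      refine Submodule.mem_span_singleton.2 ⟨c * ‖v‖, ?_⟩
      rw [smul_smul, mul_assoc, mul_inv_cancel₀ hn, mul_one]
    · rw [Submodule.span_singleton_le_iff_mem]
      exact Submodule.smul_mem _ _ hv

theorem angleWithLine_eq (hu : u 0 ^ 2 + u 1 ^ 2 = 1) (hℓ : ℓ.direction = ℝ ∙ u) (v : Plane) :
    angleWithLine ℓ v = Real.arccos (|inner ℝ u v| / ‖v‖) := by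
  have hn := norm_axis hu
  have key : ∀ (S : Submodule ℝ Plane), S = ℝ ∙ u → ∀ [S.HasOrthogonalProjection],
      S.starProjection v = inner ℝ u v • u := by
    rintro S rfl _
    exact Submodule.starProjection_unit_singleton ℝ hn v
  rw [angleWithLine, key _ hℓ, InnerProductGeometry.angle, inner_smul_right, norm_smul, hn,
    mul_one, Real.norm_eq_abs, real_inner_comm]
  congr 1
  rw [real_inner_comm]
  rcases eq_or_ne (inner ℝ u v : ℝ) 0 with h0 | h0
  · rw [h0]; simp
  · rw [← abs_mul_abs_self, mul_comm ‖v‖, mul_div_mul_left _ _ (abs_pos.2 h0).ne']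

theorem frame_sOppSide (ho : o ∈ ℓ) (hℓ : ℓ.direction = ℝ ∙ u) {p q : ℝ × ℝ}
    (hp : 0 < p.2) (hq : q.2 < 0) : ℓ.SOppSide (frame o u hu p) (frame o u hu q) := by
  refine ⟨⟨frame o u hu (p.1, 0), (frame_mem_iff ho hℓ _).2 rfl,
    frame o u hu (q.1, 0), (frame_mem_iff ho hℓ _).2 rfl, ?_⟩, ?_, ?_⟩
  · have h1 : frame o u hu p -ᵥ frame o u hu (p.1, 0) = p.2 • (!₂[-u 1, u 0] : Plane) := by
      ext i
      fin_cases i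
      · simp [frame_apply_zero]
      · simp [frame_apply_one]
    have h2 : frame o u hu (q.1, 0) -ᵥ frame o u hu q = (-q.2) • (!₂[-u 1, u 0] : Plane) := by
      ext i
      fin_cases i
      · simp [frame_apply_zero]
      · simp [frame_apply_one]
    rw [h1, h2]
    exact ((SameRay.refl _).nonneg_smul_left hp.le).nonneg_smul_right (by linarith)
  · rw [frame_mem_iff ho hℓ]; exact hp.ne'
  · rw [frame_mem_iff ho hℓ]; exact hq.ne

theorem mul_pos_of_sSameSide (ho : o ∈ ℓ) (hℓ : ℓ.direction = ℝ ∙ u) {p q : ℝ × ℝ}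
    (h : ℓ.SSameSide (frame o u hu p) (frame o u hu q)) : 0 < p.2 * q.2 := by
  obtain ⟨⟨x, hx, y, hy, hray⟩, hp, hq⟩ := h
  obtain ⟨x, rfl⟩ := (frame o u hu).surjective x
  obtain ⟨y, rfl⟩ := (frame o u hu).surjective y
  rw [frame_mem_iff ho hℓ] at hx hy hp hq
  have aux : ∀ a b : ℝ × ℝ, frame o u hu a -ᵥ frame o u hu b = 0 → a.2 = b.2 := fun a b hab ↦ by
    rw [vsub_eq_zero_iff_eq] at hab
    rw [(frame o u hu).injective hab]
  rcases hray with h0 | h0 | ⟨r, s, hr, hs, h0⟩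
  · exact absurd (aux _ _ h0) (by rwa [hx])
  · exact absurd (aux _ _ h0) (by rwa [hy])
  · have e0 := congrArg (fun z : Plane ↦ z 0) h0
    have e1 := congrArg (fun z : Plane ↦ z 1) h0
    simp [frame_apply_zero, frame_apply_one] at e0 e1
    have e2 : r * p.2 = s * q.2 := by
      linear_combination (s * q.2 - r * p.2) * hu + u 0 * e1 - u 1 * e0 + r * hx - s * hy +
        (r * x.2 - s * y.2) * hu
    have : 0 < s * (p.2 * q.2) := by
      have : s * (p.2 * q.2) = r * (p.2 * p.2) := by linear_combination (-p.2) * e2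
      rw [this]
      exact mul_pos hr (mul_self_pos.2 hp)
    exact (mul_pos_iff_of_pos_left hs).1 this

end frame

/-- The corners of the rectangle with centre `m` and half-diagonals `d` and `e`. -/
noncomputable def diagCorner (m d e : ℝ × ℝ) : Fin 4 → ℝ × ℝ := ![m + d, m + e, m - d, m - e]

section coordinates

variable {o u : Plane} {hu : u 0 ^ 2 + u 1 ^ 2 = 1}

theorem exists_corner_eq (hu : u 0 ^ 2 + u 1 ^ 2 = 1) (R : Rectangle) : ∃ m d e : ℝ × ℝ,
    (∀ i, R.corner i = frame o u hu (diagCorner m d e i)) ∧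
    d.1 ^ 2 + d.2 ^ 2 = e.1 ^ 2 + e.2 ^ 2 ∧ d.1 * e.2 - d.2 * e.1 ≠ 0 := by
  have hex : ∀ i, ∃ q, frame o u hu q = R.corner i := fun i ↦ (frame o u hu).surjective _
  choose q hq using hex
  have hpar := R.parallelogram
  have hperp := R.perp
  have h01 := R.ne_one
  have h03 := R.ne_three
  simp only [← hq] at hpar hperp h01 h03
  rw [inner_frame_sub] at hperp
  have hsum : q 1 = q 0 + q 2 - q 3 := by
    have e0 := congrArg (fun z : Plane ↦ z 0) hpar
    have e1 := congrArg (fun z : Plane ↦ z 1) hpar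
    simp [frame_apply_zero, frame_apply_one] at e0 e1
    ext
    · simp
      linear_combination (-(q 1).1 + (q 0).1 + (q 2).1 - (q 3).1) * hu + u 0 * e0 + u 1 * e1
    · simp
      linear_combination (-(q 1).2 + (q 0).2 + (q 2).2 - (q 3).2) * hu + u 0 * e1 - u 1 * e0
  have hs1 : (q 1).1 = (q 0).1 + (q 2).1 - (q 3).1 := by rw [hsum]; simp
  have hs2 : (q 1).2 = (q 0).2 + (q 2).2 - (q 3).2 := by rw [hsum]; simp
  refine ⟨(1 / 2 : ℝ) • (q 0 + q 2), (1 / 2 : ℝ) • (q 0 - q 2), (1 / 2 : ℝ) • (q 1 - q 3),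
    fun i ↦ ?_, ?_, fun hc ↦ ?_⟩
  · rw [← hq]
    congr 1
    fin_cases i <;> ext <;> simp [diagCorner, hs1, hs2] <;> ring
  · simp
    rw [hs1, hs2] at hperp ⊢
    linear_combination hperp
  · simp at hc
    rw [hs1, hs2] at hperp hc
    have pos : ∀ i, frame o u hu (q 0) ≠ frame o u hu (q i) →
        0 < ((q i).1 - (q 0).1) ^ 2 + ((q i).2 - (q 0).2) ^ 2 := by
      intro i hi
      by_contra! h0
      have a1 : (q i).1 - (q 0).1 = 0 := by
        nlinarith [sq_nonneg ((q i).1 - (q 0).1), sq_nonneg ((q i).2 - (q 0).2)]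
      have a2 : (q i).2 - (q 0).2 = 0 := by
        nlinarith [sq_nonneg ((q i).1 - (q 0).1), sq_nonneg ((q i).2 - (q 0).2)]
      exact hi (congrArg _ (Prod.ext (by linarith) (by linarith)))
    have := mul_pos (pos 1 h01) (pos 3 h03)
    rw [hs1, hs2] at this
    have hz : ∀ a b a' b' : ℝ, a * a' + b * b' = 0 → a * b' - b * a' = 0 →
        (a ^ 2 + b ^ 2) * (a' ^ 2 + b' ^ 2) = 0 := fun a b a' b' h1 h2 ↦ by
      linear_combination (a * a' + b * b') * h1 + (a * b' - b * a') * h2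
    exact this.ne' (hz _ _ _ _ hperp (by linear_combination 2 * hc))

theorem area_eq {R : Rectangle} {m d e : ℝ × ℝ}
    (hcor : ∀ i, R.corner i = frame o u hu (diagCorner m d e i))
    (hn : d.1 ^ 2 + d.2 ^ 2 = e.1 ^ 2 + e.2 ^ 2) :
    R.area = 2 * |d.1 * e.2 - d.2 * e.1| := by
  rw [Rectangle.area, hcor, hcor, hcor, dist_frame, dist_frame, ← Real.sqrt_mul (by positivity)]
  simp only [diagCorner, Matrix.cons_val, Prod.fst_add, Prod.snd_add, Prod.fst_sub, Prod.snd_sub]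
  rw [← abs_two, ← abs_mul, ← Real.sqrt_sq_eq_abs]
  congr 1
  linear_combination (d.1 ^ 2 + d.2 ^ 2 - e.1 ^ 2 - e.2 ^ 2) * hn

theorem isSquare_iff {R : Rectangle} {m d e : ℝ × ℝ}
    (hcor : ∀ i, R.corner i = frame o u hu (diagCorner m d e i)) :
    R.IsSquare ↔ d.1 * e.1 + d.2 * e.2 = 0 := by
  rw [Rectangle.IsSquare, hcor, hcor, hcor, dist_frame, dist_frame,
    Real.sqrt_inj (by positivity) (by positivity)]
  simp only [diagCorner, Matrix.cons_val, Prod.fst_add, Prod.snd_add, Prod.fst_sub, Prod.snd_sub]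
  constructor <;> intro h <;> linarith

/-- The rectangle with centre `m` and half-diagonals `d` and `e` in the coordinates of a frame. -/
noncomputable def rectangleOfDiag (hu : u 0 ^ 2 + u 1 ^ 2 = 1) (m d e : ℝ × ℝ)
    (hn : d.1 ^ 2 + d.2 ^ 2 = e.1 ^ 2 + e.2 ^ 2) (hc : d.1 * e.2 - d.2 * e.1 ≠ 0) :
    Rectangle where
  corner i := frame o u hu (diagCorner m d e i)
  parallelogram := by
    ext i
    fin_cases i <;> simp [frame_apply_zero, frame_apply_one, diagCorner] <;> ring
  perp := by
    rw [inner_frame_sub]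
    simp [diagCorner]
    linear_combination hn
  ne_one h := hc (by
    have := (frame o u hu).injective h
    simp [diagCorner] at this
    rw [this]; ring)
  ne_three h := hc (by
    have := (frame o u hu).injective h
    simp [diagCorner, sub_eq_add_neg] at this
    rw [this]; simp; ring)

theorem isMaxRect_of_isMAIR {C : Set Plane} (hconv : Convex ℝ C)
    {ℓ : AffineSubspace ℝ Plane} [Nonempty ℓ] (ho : o ∈ ℓ) (hℓ : ℓ.direction = ℝ ∙ u)
    (hsymm : EuclideanGeometry.reflection ℓ '' C = C) {R : Rectangle} (hR : IsMAIR C R)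
    {m d e : ℝ × ℝ} (hcor : ∀ i, R.corner i = frame o u hu (diagCorner m d e i))
    (hn : d.1 ^ 2 + d.2 ^ 2 = e.1 ^ 2 + e.2 ^ 2) (hc : d.1 * e.2 - d.2 * e.1 ≠ 0) :
    IsMaxRect (frame o u hu ⁻¹' C) m d e := by
  have hmem : ∀ i, diagCorner m d e i ∈ frame o u hu ⁻¹' C := fun i ↦ by
    rw [Set.mem_preimage, ← hcor]
    exact hR.1 (subset_convexHull ℝ _ ⟨i, rfl⟩)
  refine ⟨convex_preimage_frame hconv, fun p hp ↦ ?_, hn, hc, hmem 0, hmem 2, hmem 1, hmem 3, ?_⟩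
  · rw [Set.mem_preimage, ← reflection_frame ho hℓ, ← hsymm]
    exact ⟨_, hp, rfl⟩
  · intro m' d' e' hn' h1 h2 h3 h4
    by_cases hc' : d'.1 * e'.2 - d'.2 * e'.1 = 0
    · rw [hc', abs_zero]
      exact abs_nonneg _
    · have := hR.2 (rectangleOfDiag (o := o) hu m' d' e' hn' hc') (convexHull_min ?_ hconv)
      · rw [area_eq hcor hn, area_eq (fun _ ↦ rfl) hn'] at this
        linarith
      · rintro _ ⟨i, rfl⟩
        fin_cases i
        exacts [h1, h3, h2, h4]

end coordinates

namespace IsMaxRect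

variable {K : Set (ℝ × ℝ)} {m d e : ℝ × ℝ}

theorem diagCorner_mirror (i : Fin 4) :
    diagCorner (m.1, -m.2) (d.1, -d.2) (e.1, -e.2) i =
      ((diagCorner m d e i).1, -(diagCorner m d e i).2) := by
  fin_cases i <;> simp [diagCorner] <;> ring

theorem not_adjacent (h : IsMaxRect K m d e) (i : Fin 4) (h1 : (diagCorner m d e i).2 = 0)
    (h2 : (diagCorner m d e (i + 1)).2 = 0) : False := by
  have hn := h.exists_neg
  have hp := h.exists_pos
  fin_cases i <;> simp [diagCorner] at h1 h2 <;>
    rcases hn with k | k | k | k <;> rcases hp with l | l | l | l <;> linarith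

theorem exists_upper_corner_notMem_interior (h : IsMaxRect K m d e)
    (hax : ∀ i, (diagCorner m d e i).2 = 0 → diagCorner m d e i ∈ interior K) :
    ∃ i, 0 < (diagCorner m d e i).2 ∧ diagCorner m d e i ∉ interior K := by
  by_contra! hcon
  have key : ∀ i, 0 ≤ (diagCorner m d e i).2 → diagCorner m d e i ∈ interior K := fun i hi ↦ by
    rcases hi.eq_or_lt with h0 | h0
    · exact hax i h0.symm
    · exact hcon i h0
  exact h.false_of_upper_corners_mem_interior (key 0) (key 2) (key 1) (key 3)

theorem exists_lower_corner_notMem_interior (h : IsMaxRect K m d e)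
    (hax : ∀ i, (diagCorner m d e i).2 = 0 → diagCorner m d e i ∈ interior K) :
    ∃ i, (diagCorner m d e i).2 < 0 ∧ diagCorner m d e i ∉ interior K := by
  obtain ⟨i, h1, h2⟩ := h.mirror.exists_upper_corner_notMem_interior fun i hi ↦ by
    rw [diagCorner_mirror] at hi ⊢
    exact mem_interior_mirror h.symm (hax i (by simpa using hi))
  rw [diagCorner_mirror] at h1 h2
  exact ⟨i, by simpa using h1, fun h3 ↦ h2 (mem_interior_mirror h.symm h3)⟩

theorem not_three_corners_pos (h : IsMaxRect K m d e) (hperp : d.1 * e.1 + d.2 * e.2 = 0)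
    (l : Fin 4) (hl : ∀ i, i ≠ l → 0 < (diagCorner m d e i).2) : False := by
  have h0 := hl 0
  have h1 := hl 1
  have h2 := hl 2
  have h3 := hl 3
  simp only [diagCorner, Matrix.cons_val, Prod.snd_add, Prod.snd_sub] at h0 h1 h2 h3
  fin_cases l
  · exact h.swap.neg_right.false_of_three_pos (by simp; linarith) (h1 (by decide))
      (h3 (by decide)) (by simpa [sub_eq_add_neg] using h2 (by decide))
  · exact h.neg_right.false_of_three_pos (by simp; linarith) (h0 (by decide))
      (h2 (by decide)) (by simpa [sub_eq_add_neg] using h3 (by decide))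
  · exact h.swap.false_of_three_pos (by linarith) (h1 (by decide))
      (h3 (by decide)) (h0 (by decide))
  · exact h.false_of_three_pos hperp (h0 (by decide)) (h2 (by decide)) (h1 (by decide))

/-- The axis contains an interior point of every convex set that contains the corners. -/
theorem exists_axis_mem_interior (h : IsMaxRect K m d e) {S : Set (ℝ × ℝ)} (hS : Convex ℝ S)
    (hmem : ∀ i, diagCorner m d e i ∈ S) : ∃ x : ℝ, (x, 0) ∈ interior S := by
  obtain ⟨s, t, hst, h0⟩ : ∃ s t : ℝ, |s| + |t| < 1 ∧ m.2 + s * d.2 + t * e.2 = 0 := by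
    have aux : ∀ a : ℝ, |m.2| < |a| → |-m.2 / a| < 1 ∧ m.2 + -m.2 / a * a = 0 := fun a ha ↦ by
      have hpos : 0 < |a| := (abs_nonneg _).trans_lt ha
      refine ⟨by rwa [abs_div, abs_neg, div_lt_one hpos], ?_⟩
      rw [div_mul_cancel₀ _ (abs_pos.1 hpos)]
      ring
    by_cases hd : |m.2| < |d.2|
    · exact ⟨-m.2 / d.2, 0, by simpa using (aux _ hd).1, by simpa using (aux _ hd).2⟩
    by_cases he : |m.2| < |e.2|
    · exact ⟨0, -m.2 / e.2, by simpa using (aux _ he).1, by simpa using (aux _ he).2⟩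
    exfalso
    push Not at hd he
    have hn := h.exists_neg
    have hp := h.exists_pos
    have d1 := neg_abs_le d.2
    have d2 := le_abs_self d.2
    have e1 := neg_abs_le e.2
    have e2 := le_abs_self e.2
    rcases abs_cases m.2 with ⟨q, _⟩ | ⟨q, _⟩
    · rcases hn with k | k | k | k <;> linarith
    · rcases hp with k | k | k | k <;> linarith
  refine ⟨m.1 + s * d.1 + t * e.1, ?_⟩
  convert mem_interior_of_abs_add_abs_lt hS (hmem 0) (hmem 2) (hmem 1) (hmem 3) h.cross_ne hst
    using 1
  ext
  · simp
  · simpa using h0.symm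

end IsMaxRect

theorem arccos_bounds {d1 e1 e2 : ℝ} (hn : d1 ^ 2 = e1 ^ 2 + e2 ^ 2) (hd : d1 ≠ 0) (he : e1 ≠ 0)
    (hle : 2 * |e1| ≤ |d1|) :
    Real.pi / 6 ≤ min (Real.arccos (|e1 - d1| / √((e1 - d1) ^ 2 + e2 ^ 2)))
      (Real.arccos (|e1 + d1| / √((e1 + d1) ^ 2 + e2 ^ 2))) ∧
    min (Real.arccos (|e1 - d1| / √((e1 - d1) ^ 2 + e2 ^ 2)))
      (Real.arccos (|e1 + d1| / √((e1 + d1) ^ 2 + e2 ^ 2))) < Real.pi / 4 := by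
  have hpi := Real.pi_pos
  have hd2 : 0 < d1 ^ 2 := by positivity
  have he2 : 0 < e1 ^ 2 := by positivity
  have h4 : 4 * e1 ^ 2 ≤ d1 ^ 2 := by
    have := pow_le_pow_left₀ (by positivity) hle 2
    rw [mul_pow, sq_abs, sq_abs] at this
    linarith
  have hprod : 2 * |e1 * d1| ≤ d1 ^ 2 := by
    rw [abs_mul, ← sq_abs d1]
    nlinarith [abs_nonneg d1]
  obtain ⟨p1, p2⟩ := abs_le.1 (by linarith : |e1 * d1| ≤ d1 ^ 2 / 2)
  have pos : ∀ a : ℝ, a = e1 - d1 ∨ a = e1 + d1 → 0 < a ^ 2 + e2 ^ 2 := by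
    rintro a (rfl | rfl) <;> nlinarith
  have low : ∀ a : ℝ, a = e1 - d1 ∨ a = e1 + d1 →
      Real.pi / 6 ≤ Real.arccos (|a| / √(a ^ 2 + e2 ^ 2)) := by
    intro a ha
    have hp := pos a ha
    rw [← Real.arccos_cos (x := Real.pi / 6) (by positivity) (by linarith),
      Real.cos_pi_div_six]
    refine Real.arccos_le_arccos ?_
    rw [div_le_iff₀ (Real.sqrt_pos.2 hp), div_mul_eq_mul_div, ← Real.sqrt_mul (by norm_num),
      le_div_iff₀ (by norm_num)]
    refine Real.le_sqrt_of_sq_le ?_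
    rw [mul_pow, sq_abs]
    rcases ha with rfl | rfl <;> nlinarith
  have high : ∀ a : ℝ, e2 ^ 2 < a ^ 2 → Real.arccos (|a| / √(a ^ 2 + e2 ^ 2)) < Real.pi / 4 := by
    intro a ha
    have hp : 0 < a ^ 2 + e2 ^ 2 := by nlinarith [sq_nonneg e2]
    rw [← Real.arccos_cos (x := Real.pi / 4) (by positivity) (by linarith),
      Real.cos_pi_div_four]
    refine Real.arccos_lt_arccos ?_ ?_ ?_
    · have := Real.sqrt_nonneg 2
      linarith
    · rw [lt_div_iff₀ (Real.sqrt_pos.2 hp), div_mul_eq_mul_div, ← Real.sqrt_mul (by norm_num),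
        div_lt_iff₀ (by norm_num)]
      have hpos : 0 < |a| := abs_pos.2 fun h0 ↦ by
        subst h0
        linarith [sq_nonneg e2]
      refine (Real.sqrt_lt' (by positivity)).2 ?_
      rw [mul_pow, sq_abs]
      linarith
    · rw [div_le_one (Real.sqrt_pos.2 hp)]
      refine Real.le_sqrt_of_sq_le ?_
      rw [sq_abs]
      linarith [sq_nonneg e2]
  refine ⟨le_min (low _ (Or.inl rfl)) (low _ (Or.inr rfl)), ?_⟩
  rcases lt_or_gt_of_ne (mul_ne_zero he hd) with h | h
  · exact (min_le_left _ _).trans_lt (high _ (by nlinarith))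
  · exact (min_le_right _ _).trans_lt (high _ (by nlinarith))

theorem IsMaxRect.mem_interior_of_notMem_extremePoints {C : Set Plane} {o u : Plane}
    {hu : u 0 ^ 2 + u 1 ^ 2 = 1} {ℓ : AffineSubspace ℝ Plane} (ho : o ∈ ℓ)
    (hℓ : ℓ.direction = ℝ ∙ u) {m d e : ℝ × ℝ} (h : IsMaxRect (frame o u hu ⁻¹' C) m d e)
    {p : ℝ × ℝ} (hp : p ∈ frame o u hu ⁻¹' C) (hp2 : p.2 = 0)
    (hext : frame o u hu p ∉ Set.extremePoints ℝ (symAxis ℓ C)) :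
    p ∈ interior (frame o u hu ⁻¹' C) := by
  have hmem : frame o u hu p ∈ symAxis ℓ C := ⟨(frame_mem_iff ho hℓ _).2 hp2, hp⟩
  rw [mem_extremePoints_iff_left] at hext
  push Not at hext
  obtain ⟨x, hx, y, hy, hseg, hne⟩ := hext hmem
  obtain ⟨x, rfl⟩ := (frame o u hu).surjective x
  obtain ⟨y, rfl⟩ := (frame o u hu).surjective y
  obtain ⟨a, b, ha, hb, hab, heq⟩ := hseg
  rw [← frame_combo hab] at heq
  have heq := (frame o u hu).injective heq
  have hx2 : x.2 = 0 := (frame_mem_iff ho hℓ _).1 hx.1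
  have h1 : a * x.1 + b * y.1 = p.1 := by rw [← heq]; simp
  have hne1 : x.1 ≠ p.1 := fun h0 ↦ hne (congrArg _ (Prod.ext h0 (by rw [hx2, hp2])))
  have hp' : p = (p.1, 0) := Prod.ext rfl hp2
  obtain rfl : a = 1 - b := by linarith
  have e1 : b * (y.1 - x.1) = p.1 - x.1 := by linarith
  have e2 : (1 - b) * (y.1 - x.1) = y.1 - p.1 := by linarith
  rw [hp']
  rcases lt_or_gt_of_ne hne1 with hlt | hlt
  · have : 0 < y.1 - x.1 := (mul_pos_iff_of_pos_left hb).1 (by linarith)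
    exact h.mem_interior_of_lt_of_lt hx.2 hy.2 hlt (by nlinarith)
  · have : 0 < x.1 - y.1 := (mul_pos_iff_of_pos_left hb).1 (by linarith)
    exact h.mem_interior_of_lt_of_lt hy.2 hx.2 (by nlinarith) hlt

theorem angle_eq {o u : Plane} {hu : u 0 ^ 2 + u 1 ^ 2 = 1} {ℓ : AffineSubspace ℝ Plane}
    (hℓ : ℓ.direction = ℝ ∙ u) {R : Rectangle} {m d e : ℝ × ℝ}
    (hcor : ∀ i, R.corner i = frame o u hu (diagCorner m d e i)) :
    R.angle ℓ = min (Real.arccos (|e.1 - d.1| / √((e.1 - d.1) ^ 2 + (e.2 - d.2) ^ 2)))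
      (Real.arccos (|e.1 + d.1| / √((e.1 + d.1) ^ 2 + (e.2 + d.2) ^ 2))) := by
  rw [Rectangle.angle, angleWithLine_eq hu hℓ, angleWithLine_eq hu hℓ, hcor, hcor, hcor,
    inner_axis_frame_sub, inner_axis_frame_sub, ← dist_eq_norm, ← dist_eq_norm, dist_frame,
    dist_frame]
  simp only [diagCorner, Matrix.cons_val, Prod.fst_add, Prod.snd_add, Prod.fst_sub, Prod.snd_sub]
  rw [show m.1 + e.1 - (m.1 + d.1) = e.1 - d.1 by ring,
    show m.2 + e.2 - (m.2 + d.2) = e.2 - d.2 by ring,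
    show m.1 - e.1 - (m.1 + d.1) = -(e.1 + d.1) by ring,
    show m.2 - e.2 - (m.2 + d.2) = -(e.2 + d.2) by ring, abs_neg, neg_sq, neg_sq]

theorem mainTheorem3 (C : Set Plane) (hconv : Convex ℝ C) (hcomp : IsCompact C)
    (ℓ : AffineSubspace ℝ Plane) [Nonempty ℓ] (hline : Module.finrank ℝ ℓ.direction = 1)
    (hsymm : EuclideanGeometry.reflection ℓ '' C = C)
    (R : Rectangle) (hR : IsMAIR C R) :
    -- the line meets the rectangle, in neither a single point nor an edge: it meets the interior
    ((((ℓ : Set Plane) ∩ R.toSet).Nonempty ∧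
        (∀ x : Plane, (ℓ : Set Plane) ∩ R.toSet ≠ {x}) ∧
        (∀ i : Fin 4, (ℓ : Set Plane) ∩ R.toSet ≠ R.edge i)) ∧
      ((ℓ : Set Plane) ∩ interior R.toSet).Nonempty) ∧
    -- unless a corner is an end point of the axis, both sides have a corner on the boundary
    ((¬ ∃ i : Fin 4, R.corner i ∈ Set.extremePoints ℝ (symAxis ℓ C)) →
      ∃ i j : Fin 4, R.corner i ∈ frontier C ∧ R.corner j ∈ frontier C ∧
        ℓ.SOppSide (R.corner i) (R.corner j)) ∧
    -- a square does not have three corners strictly on one side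
    (R.IsSquare → ¬ ∃ i j k : Fin 4, i ≠ j ∧ j ≠ k ∧ i ≠ k ∧
      ℓ.SSameSide (R.corner i) (R.corner j) ∧ ℓ.SSameSide (R.corner j) (R.corner k)) ∧
    -- two corners on the axis force a square, or an angle in `[π/6, π/4)`
    ((∃ i j : Fin 4, i ≠ j ∧ R.corner i ∈ symAxis ℓ C ∧ R.corner j ∈ symAxis ℓ C) →
      R.IsSquare ∨ (Real.pi / 6 ≤ R.angle ℓ ∧ R.angle ℓ < Real.pi / 4)) := by
  obtain ⟨o, u, hu, ho, hℓ⟩ := exists_frame hline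
  obtain ⟨m, d, e, hcor, hn, hc⟩ := exists_corner_eq (o := o) hu R
  have h := isMaxRect_of_isMAIR hconv ho hℓ hsymm hR hcor hn hc
  have hK : ∀ i, diagCorner m d e i ∈ frame o u hu ⁻¹' C := fun i ↦ by
    rw [Set.mem_preimage, ← hcor]
    exact hR.1 (subset_convexHull ℝ _ ⟨i, rfl⟩)
  have hint : ∀ p, p ∈ interior (frame o u hu ⁻¹' C) ↔ frame o u hu p ∈ interior C := fun p ↦ by
    rw [← (frame o u hu).preimage_interior, Set.mem_preimage]
  refine ⟨?_, fun hext ↦ ?_, fun hsq ⟨i, j, k, hij, hjk, hik, h1, h2⟩ ↦ ?_,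
    fun ⟨i, j, hij, hi, hj⟩ ↦ ?_⟩
  · obtain ⟨x, hx⟩ := h.exists_axis_mem_interior (S := frame o u hu ⁻¹' R.toSet)
      (convex_preimage_frame (convex_convexHull ℝ _)) fun i ↦ by
        rw [Set.mem_preimage, ← hcor]
        exact subset_convexHull ℝ _ ⟨i, rfl⟩
    have hxℓ : ∀ y : ℝ, frame o u hu (y, 0) ∈ ℓ := fun y ↦ (frame_mem_iff ho hℓ _).2 rfl
    have hxR := interior_subset hx
    refine ⟨⟨⟨_, hxℓ x, hxR⟩, fun y hy ↦ ?_, fun i hi ↦ ?_⟩, ⟨_, hxℓ x, ?_⟩⟩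
    · have hcont : Continuous fun t : ℝ ↦ (t, (0 : ℝ)) := by fun_prop
      have hev : ∀ᶠ t in 𝓝 x, (t, (0 : ℝ)) ∈ frame o u hu ⁻¹' R.toSet :=
        (hcont.tendsto x).eventually (mem_interior_iff_mem_nhds.1 hx)
      obtain ⟨t, ht, htx⟩ := ((hev.filter_mono (nhdsWithin_le_nhds (s := Set.Ioi x))).and
        self_mem_nhdsWithin).exists
      have e1 : frame o u hu (x, 0) = y := by
        have : frame o u hu (x, 0) ∈ ((ℓ : Set Plane) ∩ R.toSet) := ⟨hxℓ x, hxR⟩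
        rwa [hy] at this
      have e2 : frame o u hu (t, 0) = y := by
        have : frame o u hu (t, 0) ∈ ((ℓ : Set Plane) ∩ R.toSet) := ⟨hxℓ t, ht⟩
        rwa [hy] at this
      have := congrArg Prod.fst ((frame o u hu).injective (e1.trans e2.symm))
      exact (ne_of_gt htx) this.symm
    · have e1 : R.corner i ∈ (ℓ : Set Plane) ∩ R.toSet := hi ▸ left_mem_segment ℝ _ _
      have e2 : R.corner (i + 1) ∈ (ℓ : Set Plane) ∩ R.toSet := hi ▸ right_mem_segment ℝ _ _
      have e1 := e1.1
      have e2 := e2.1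
      rw [hcor, SetLike.mem_coe, frame_mem_iff ho hℓ] at e1 e2
      exact h.not_adjacent i e1 e2
    · rw [← (frame o u hu).preimage_interior] at hx
      exact hx
  · have hax : ∀ i, (diagCorner m d e i).2 = 0 →
        diagCorner m d e i ∈ interior (frame o u hu ⁻¹' C) := fun i hi ↦
      h.mem_interior_of_notMem_extremePoints ho hℓ (hK i) hi fun h0 ↦ hext ⟨i, by rwa [hcor]⟩
    obtain ⟨i, hi, hi'⟩ := h.exists_upper_corner_notMem_interior hax
    obtain ⟨j, hj, hj'⟩ := h.exists_lower_corner_notMem_interior hax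
    rw [hint] at hi' hj'
    refine ⟨i, j, ?_, ?_, ?_⟩
    · rw [hcor]; exact ⟨subset_closure (hK i), hi'⟩
    · rw [hcor]; exact ⟨subset_closure (hK j), hj'⟩
    · rw [hcor, hcor]; exact frame_sOppSide ho hℓ hi hj
  · rw [hcor, hcor] at h1 h2
    have p1 := mul_pos_of_sSameSide ho hℓ h1
    have p2 := mul_pos_of_sSameSide ho hℓ h2
    have hperp := (isSquare_iff hcor).1 hsq
    obtain ⟨l, hl⟩ : ∃ l, ∀ x, x ≠ l → x = i ∨ x = j ∨ x = k := by
      clear * - hij hjk hik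
      revert i j k
      decide
    rcases lt_or_gt_of_ne (left_ne_zero_of_mul p2.ne') with h0 | h0
    · refine h.mirror.not_three_corners_pos (by simpa using hperp) l fun x hx ↦ ?_
      rw [IsMaxRect.diagCorner_mirror]
      rcases hl x hx with rfl | rfl | rfl
      · exact neg_pos.2 (by nlinarith)
      · exact neg_pos.2 h0
      · exact neg_pos.2 (by nlinarith)
    · refine h.not_three_corners_pos hperp l fun x hx ↦ ?_
      rcases hl x hx with rfl | rfl | rfl
      · exact (mul_pos_iff_of_pos_right h0).1 p1
      · exact h0
      · exact (mul_pos_iff_of_pos_left h0).1 p2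
  · have hi := hi.1
    have hj := hj.1
    rw [hcor, SetLike.mem_coe, frame_mem_iff ho hℓ] at hi hj
    obtain ⟨h0, h2⟩ | ⟨h1, h3⟩ : (diagCorner m d e 0).2 = 0 ∧ (diagCorner m d e 2).2 = 0 ∨
        (diagCorner m d e 1).2 = 0 ∧ (diagCorner m d e 3).2 = 0 := by
      have hadj := h.not_adjacent
      fin_cases i <;> fin_cases j <;> first
        | exact absurd rfl hij
        | exact Or.inl ⟨hi, hj⟩
        | exact Or.inl ⟨hj, hi⟩
        | exact Or.inr ⟨hi, hj⟩
        | exact Or.inr ⟨hj, hi⟩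
        | exact (hadj _ hi hj).elim
        | exact (hadj _ hj hi).elim
    · simp only [diagCorner, Matrix.cons_val, Prod.snd_add, Prod.snd_sub] at h0 h2
      have hm2 : m.2 = 0 := by linarith
      have hd2 : d.2 = 0 := by linarith
      by_cases he : e.1 = 0
      · left
        rw [isSquare_iff hcor, hd2, he]
        ring
      · right
        have := arccos_bounds (d1 := d.1) (e1 := e.1) (e2 := e.2) (by rw [← hn, hd2]; ring)
          (fun h0 ↦ hc (by rw [h0, hd2]; ring)) he (h.two_mul_abs_le hm2 hd2)
        rwa [angle_eq hℓ hcor, hd2, sub_zero, add_zero]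
    · simp only [diagCorner, Matrix.cons_val, Prod.snd_add, Prod.snd_sub] at h1 h3
      have hm2 : m.2 = 0 := by linarith
      have he2 : e.2 = 0 := by linarith
      by_cases hd : d.1 = 0
      · left
        rw [isSquare_iff hcor, he2, hd]
        ring
      · right
        have := arccos_bounds (d1 := e.1) (e1 := d.1) (e2 := d.2) (by rw [hn, he2]; ring)
          (fun h0 ↦ hc (by rw [h0, he2]; ring)) hd (h.swap.two_mul_abs_le hm2 he2)
        rwa [angle_eq hℓ hcor, he2, zero_sub, zero_add, neg_sq, abs_sub_comm, add_comm e.1,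
          ← neg_sq (e.1 - d.1), neg_sub]
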